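/- Let $G$ be a finitely generated group with a finite generating set $S$, and for $g \in G$ let $\|g\|_S$ be the word length of $g$ with respect to $S$ (the least length of a word in elements of $S$ and their inverses representing $g$). For $g \in G$ with $g \neq 1$ put $$k_G^{nil}(g) = \min\{\, |G/N| : N \trianglelefteq G,\ G/N \text{ is finite and nilpotent},\ g \notin N \,\},$$ with $k_G^{nil}(g) = \infty$ if no such $N$ exists, and for $n \in \mathbb{N}$ put $$F_G^{nil}(n) = \max\{\, k_G^{nil}(g) : g \in G,\ g \neq 1,\ \|g\|_S \leq n \,\} \in \mathbb{N} \cup \{\infty\}$$ (with $F_G^{nil}(n) = 0$ if there is no such $g$). For functions $f_1, f_2$ on the natural numbers with values in $[0,\infty]$, write $f_1(n) \preceq f_2(n)$ if there is a constant $C \in \mathbb{N}$ such that $f_1(n) \leq C f_2(Cn)$ for all integers $n \geq 1$. Then $G$ is nilpotent if and only if $F_G^{nil}(n)$ grows polynomially in $\log n$, that is, there is a natural number $d$ with $F_G^{nil}(n) \preceq (\log n)^d$. Moreover, if $G$ is not nilpotent, then $F_G^{nil}$ grows at least linearly: $n \preceq F_G^{nil}(n)$. -/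

import Mathlib

/-- The word length `‖g‖_S`: the least length of an expression of `g` as a product of elements of
`S` and inverses of elements of `S`. -/
noncomputable def wordLength {G : Type*} [Group G] (S : Set G) (g : G) : ℕ :=
  sInf {n : ℕ | ∃ l : List G, (∀ x ∈ l, x ∈ S ∨ x⁻¹ ∈ S) ∧ l.prod = g ∧ l.length = n}

/-- The least order of a finite nilpotent quotient `G ⧸ N` in which the image of `g` is nontrivial.
It is `⊤` (infinity) if there is no such quotient. -/
noncomputable def nilDetection {G : Type*} [Group G] (g : G) : ℕ∞ :=
  sInf {m : ℕ∞ | ∃ (N : Subgroup G) (_ : N.Normal),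
    Finite (G ⧸ N) ∧ Group.IsNilpotent (G ⧸ N) ∧ g ∉ N ∧ m = (Nat.card (G ⧸ N) : ℕ∞)}

/-- The growth function `F_G^nil`: the maximum of `nilDetection g` over the nontrivial elements `g`
of word length at most `n` (and `0` if there are none). -/
noncomputable def nilGrowth {G : Type*} [Group G] (S : Set G) (n : ℕ) : ℕ∞ :=
  ⨆ g ∈ {g : G | g ≠ 1 ∧ wordLength S g ≤ n}, nilDetection g

/-- The relation `f₁ ⪯ f₂` between growth functions: `f₁ n ≤ C * f₂ (C * n)` for some
constant `C` and all positive integers `n`. -/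
def GrowthLE (f₁ f₂ : ℕ → ENNReal) : Prop :=
  ∃ C : ℕ, ∀ n : ℕ, 1 ≤ n → f₁ n ≤ (C : ENNReal) * f₂ (C * n)

/-- `f` grows polynomially in `log n`: `f ⪯ (log n) ^ d` for some natural number `d`. -/
def PolynomialInLog (f : ℕ → ENNReal) : Prop :=
  ∃ d : ℕ, GrowthLE f (fun n => ENNReal.ofReal (Real.log n ^ d))

/-! If `G` is not nilpotent, every level `k` has a nontrivial left-normed commutator in the
generators. It is short (length below `3 * 2 ^ k`) but lies so deep in the lower central series that
a finite nilpotent quotient detecting it has at least `2 ^ (k + 1)` elements. Hence growth is at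
least linear, which no power of `log n` allows (`growthLE_nilGrowth_of_not_isNilpotent`,
`not_polynomialInLog_of_linear_growthLE`).

If `G` is nilpotent, it is built from `⊥` by adjoining finitely many elements, each central modulo
its predecessors. Induction along this chain (`CentralChain.exists_separation`) attaches to each
nontrivial `g` of length `n` an integer `a`, polynomial in `n`, such that `g` survives modulo the `m
* q ^ D`-th powers whenever `q` does not divide `a`. Some `q` of size `O(log a)` is a non-divisor,
and the quotient by `e`-th powers has order polynomial in `e`, so a quotient of polylogarithmic
order detects `g`. -/

/-! ### Small non-divisors. -/

theorem Nat.two_pow_le_centralBinom (n : ℕ) : 2 ^ n ≤ Nat.centralBinom n := by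
  induction n with
  | zero => simp
  | succ n ih =>
    have h := Nat.succ_mul_centralBinom_succ n
    have h1 : (n + 1) * 2 ^ (n + 1) ≤ (n + 1) * Nat.centralBinom (n + 1) := by
      rw [h, pow_succ]
      nlinarith [Nat.zero_le (2 ^ n)]
    exact Nat.le_of_mul_le_mul_left h1 (Nat.succ_pos n)

/-- A positive integer smaller than `2 ^ n` has a non-divisor which is at most `2 * n`. -/
theorem Nat.exists_not_dvd_of_lt_two_pow {a n : ℕ} (ha : 1 ≤ a) (h : a < 2 ^ n) :
    ∃ q, 1 ≤ q ∧ q ≤ 2 * n ∧ ¬ q ∣ a := by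
  by_contra! hq
  have hn : 0 < n := by
    rcases Nat.eq_zero_or_pos n with rfl | hn
    · simp at h; omega
    · exact hn
  -- Every prime power exactly dividing the central binomial coefficient is at most `2 * n`, hence
  -- divides `a` by assumption; but the coefficient is at least `2 ^ n > a`.
  have hdvd : Nat.centralBinom n ∣ a := by
    rw [← Nat.factorization_le_iff_dvd (Nat.centralBinom_ne_zero n) (by omega)]
    intro p
    by_cases hp : p.Prime
    · have hle : p ^ (Nat.centralBinom n).factorization p ≤ 2 * n :=
        Nat.pow_factorization_choose_le (by omega)
      exact (hp.pow_dvd_iff_le_factorization (by omega)).1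
        (hq _ (Nat.one_le_pow _ _ hp.pos) hle)
    · rw [Nat.factorization_eq_zero_of_not_prime _ hp]
      exact Nat.zero_le _
  have := Nat.le_of_dvd ha hdvd
  have := Nat.two_pow_le_centralBinom n
  omega

/-! ### Iterated commutators and orders of nilpotent groups. -/

section IteratedCommutators

open scoped commutatorElement

variable {G : Type*} [Group G]

/-- The left-normed commutators `⁅⁅⁅s₀, s₁⁆, …⁆, sₖ⁆` with entries in `S`. -/
def leftNormedCommutators (S : Set G) : ℕ → Set G
  | 0 => S
  | k + 1 => {x | ∃ y ∈ leftNormedCommutators S k, ∃ s ∈ S, x = ⁅y, s⁆}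

theorem leftNormedCommutators_finite {S : Set G} (hS : S.Finite) (k : ℕ) :
    (leftNormedCommutators S k).Finite := by
  induction k with
  | zero => exact hS
  | succ k ih =>
    refine (ih.image2 (fun y s => ⁅y, s⁆) hS).subset ?_
    rintro x ⟨y, hy, s, hs, rfl⟩
    exact ⟨y, hy, s, hs, rfl⟩

theorem leftNormedCommutators_subset_lowerCentralSeries (S : Set G) (k : ℕ) :
    leftNormedCommutators S k ⊆ (⊤ : Subgroup G).lowerCentralSeries k := by
  induction k with
  | zero => intro x _; trivial
  | succ k ih =>
    rintro x ⟨y, hy, s, hs, rfl⟩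
    exact Subgroup.commutator_mem_commutator (ih hy) (Subgroup.mem_top s)

theorem leftNormedCommutators_image {H : Type*} [Group H] (f : G →* H) (S : Set G) (k : ℕ) :
    leftNormedCommutators (f '' S) k = f '' leftNormedCommutators S k := by
  induction k with
  | zero => rfl
  | succ k ih =>
    ext x
    simp only [leftNormedCommutators, ih, Set.mem_ofPred_eq, Set.mem_image]
    constructor
    · rintro ⟨_, ⟨y, hy, rfl⟩, _, ⟨s, hs, rfl⟩, rfl⟩
      exact ⟨_, ⟨y, hy, s, hs, rfl⟩, map_commutatorElement f y s⟩
    · rintro ⟨_, ⟨y, hy, s, hs, rfl⟩, rfl⟩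
      exact ⟨_, ⟨y, hy, rfl⟩, _, ⟨s, hs, rfl⟩, map_commutatorElement f y s⟩

theorem Subgroup.mem_center_of_commute_generators {S : Set G} (hS : Subgroup.closure S = ⊤)
    {y : G} (h : ∀ s ∈ S, Commute y s) : y ∈ Subgroup.center G := by
  have hle : Subgroup.closure S ≤ Subgroup.centralizer {y} := by
    rw [Subgroup.closure_le]
    intro s hs
    exact Subgroup.mem_centralizer_singleton_iff.2 (h s hs).symm.eq
  rw [Subgroup.mem_center_iff]
  intro g
  have hg : g ∈ Subgroup.centralizer {y} := hle (hS ▸ Subgroup.mem_top g)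
  exact Subgroup.mem_centralizer_singleton_iff.1 hg

/-- Induction through `G ⧸ center G`: an element commuting with all generators is central, so the
commutators one level lower die in that quotient. -/
theorem Group.isNilpotent_of_leftNormedCommutators_eq_one {G : Type*} [Group G] {S : Set G}
    (hS : Subgroup.closure S = ⊤) {k : ℕ} (h : ∀ x ∈ leftNormedCommutators S k, x = 1) :
    Group.IsNilpotent G := by
  induction k generalizing G with
  | zero =>
    have hbot : Subgroup.closure S = ⊥ := (Subgroup.closure_eq_bot_iff).2 h
    have : Subsingleton G := by
      rw [← Subgroup.subsingleton_iff]
      exact subsingleton_of_bot_eq_top (hbot.symm.trans hS)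
    infer_instance
  | succ k ih =>
    apply Group.of_quotient_center_nilpotent
    apply ih (S := QuotientGroup.mk' (Subgroup.center G) '' S)
    · rw [← MonoidHom.map_closure, hS, ← MonoidHom.range_eq_map, MonoidHom.range_eq_top]
      exact QuotientGroup.mk'_surjective _
    · rw [leftNormedCommutators_image]
      rintro _ ⟨y, hy, rfl⟩
      refine (QuotientGroup.eq_one_iff y).2 (Subgroup.mem_center_of_commute_generators hS ?_)
      intro s hs
      exact commutatorElement_eq_one_iff_commute.1 (h _ ⟨y, hy, s, hs, rfl⟩)

theorem Subgroup.lowerCentralSeries_succ_lt [Group.IsNilpotent G] {k : ℕ}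
    (h : (⊤ : Subgroup G).lowerCentralSeries k ≠ ⊥) :
    (⊤ : Subgroup G).lowerCentralSeries (k + 1) < (⊤ : Subgroup G).lowerCentralSeries k := by
  refine lt_of_le_of_ne (Subgroup.lowerCentralSeries_antitone _ (Nat.le_succ k)) fun heq => h ?_
  have hconst : ∀ n, (⊤ : Subgroup G).lowerCentralSeries (k + n) =
      (⊤ : Subgroup G).lowerCentralSeries k := by
    intro n
    induction n with
    | zero => rfl
    | succ n ih =>
      rw [← add_assoc, Subgroup.lowerCentralSeries_succ, ih, ← Subgroup.lowerCentralSeries_succ, heq]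
  obtain ⟨n, hn⟩ := Subgroup.nilpotent_iff_lowerCentralSeries.1 ‹Group.IsNilpotent G›
  rw [← hconst n, eq_bot_iff, ← hn]
  exact Subgroup.lowerCentralSeries_antitone _ (Nat.le_add_left n k)

/-- The series drops strictly at each of the steps `0, …, k`, and each drop has index at least 2. -/
theorem Group.two_pow_le_card_of_lowerCentralSeries_ne_bot [Finite G] [Group.IsNilpotent G] {k : ℕ}
    (h : (⊤ : Subgroup G).lowerCentralSeries k ≠ ⊥) : 2 ^ (k + 1) ≤ Nat.card G := by
  have key : ∀ i ≤ k + 1,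
      2 ^ i * Nat.card ((⊤ : Subgroup G).lowerCentralSeries i) ≤ Nat.card G := by
    intro i
    induction i with
    | zero => intro _; simp
    | succ i ih =>
      intro hi
      have hne : (⊤ : Subgroup G).lowerCentralSeries i ≠ ⊥ := fun h0 => h
        (eq_bot_iff.2 (h0 ▸ Subgroup.lowerCentralSeries_antitone _ (by omega : i ≤ k)))
      have hlt := Subgroup.lowerCentralSeries_succ_lt hne
      have hmul := Subgroup.relIndex_mul_relIndex _ _ _ bot_le hlt.le
      rw [Subgroup.relIndex_bot_left, Subgroup.relIndex_bot_left, mul_comm] at hmul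
      have hrel : 2 ≤ ((⊤ : Subgroup G).lowerCentralSeries (i + 1)).relIndex
          ((⊤ : Subgroup G).lowerCentralSeries i) := by
        have h1 : ((⊤ : Subgroup G).lowerCentralSeries (i + 1)).relIndex
          ((⊤ : Subgroup G).lowerCentralSeries i) ≠ 1 := fun h1 =>
            hlt.not_ge (Subgroup.relIndex_eq_one.1 h1)
        have h0 : ((⊤ : Subgroup G).lowerCentralSeries (i + 1)).relIndex
          ((⊤ : Subgroup G).lowerCentralSeries i) ≠ 0 := Subgroup.index_ne_zero_of_finite
        omega
      refine le_trans ?_ (ih (by omega))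
      rw [← hmul, pow_succ, mul_assoc]
      exact Nat.mul_le_mul_left _ (Nat.mul_le_mul_right _ hrel)
  have h1 := key (k + 1) le_rfl
  have h2 : 0 < Nat.card ((⊤ : Subgroup G).lowerCentralSeries (k + 1)) := Nat.card_pos
  nlinarith [Nat.zero_le (2 ^ (k + 1))]

end IteratedCommutators

/-! ### Word length and the linear lower bound. -/

section Growth

variable {G : Type*} [Group G] {S : Set G}

/-- `g` is a product of at most `n` elements of `S ∪ S⁻¹`. -/
def IsWordOfLength (S : Set G) (n : ℕ) (g : G) : Prop :=
  ∃ l : List G, (∀ x ∈ l, x ∈ S ∨ x⁻¹ ∈ S) ∧ l.prod = g ∧ l.length ≤ n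

theorem IsWordOfLength.mul {m n : ℕ} {g h : G} (hg : IsWordOfLength S m g)
    (hh : IsWordOfLength S n h) : IsWordOfLength S (m + n) (g * h) := by
  obtain ⟨l, hl, rfl, hlm⟩ := hg
  obtain ⟨l', hl', rfl, hln⟩ := hh
  refine ⟨l ++ l', ?_, by simp, by simp; omega⟩
  intro x hx
  rcases List.mem_append.1 hx with hx | hx
  · exact hl x hx
  · exact hl' x hx

theorem IsWordOfLength.inv {n : ℕ} {g : G} (hg : IsWordOfLength S n g) :
    IsWordOfLength S n g⁻¹ := by
  obtain ⟨l, hl, rfl, hlm⟩ := hg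
  refine ⟨(l.map (fun x => x⁻¹)).reverse, ?_, (List.prod_inv_reverse l).symm, by simpa using hlm⟩
  intro x hx
  simp only [List.mem_reverse, List.mem_map] at hx
  obtain ⟨y, hy, rfl⟩ := hx
  simpa [or_comm] using hl y hy

theorem isWordOfLength_one (n : ℕ) : IsWordOfLength S n 1 :=
  ⟨[], by simp, by simp, by simp⟩

theorem isWordOfLength_one_of_mem {s : G} (hs : s ∈ S) : IsWordOfLength S 1 s :=
  ⟨[s], by simp [hs], by simp, by simp⟩

theorem IsWordOfLength.mem_closure {n : ℕ} {g : G} (hg : IsWordOfLength S n g) :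
    g ∈ Subgroup.closure S := by
  obtain ⟨l, hl, rfl, _⟩ := hg
  refine Subgroup.list_prod_mem _ fun x hx => ?_
  rcases hl x hx with h | h
  · exact Subgroup.subset_closure h
  · exact inv_mem_iff.1 (Subgroup.subset_closure h)

theorem IsWordOfLength.pow {n : ℕ} {g : G} (hg : IsWordOfLength S n g) (m : ℕ) :
    IsWordOfLength S (m * n) (g ^ m) := by
  induction m with
  | zero => simpa using isWordOfLength_one 0
  | succ m ih =>
    rw [pow_succ, add_mul, one_mul]
    exact ih.mul hg

theorem IsWordOfLength.zpow {n : ℕ} {g : G} (hg : IsWordOfLength S n g) (i : ℤ) :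
    IsWordOfLength S (i.natAbs * n) (g ^ i) := by
  rcases Int.natAbs_eq i with h | h
  · rw [h, zpow_natCast, Int.natAbs_natCast]
    exact hg.pow _
  · rw [h, zpow_neg, zpow_natCast, Int.natAbs_neg, Int.natAbs_natCast]
    exact (hg.pow _).inv

theorem IsWordOfLength.mono {m n : ℕ} {g : G} (hg : IsWordOfLength S m g) (h : m ≤ n) :
    IsWordOfLength S n g := by
  obtain ⟨l, hl, hp, hlm⟩ := hg
  exact ⟨l, hl, hp, hlm.trans h⟩

theorem IsWordOfLength.wordLength_le {n : ℕ} {g : G} (hg : IsWordOfLength S n g) :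
    wordLength S g ≤ n := by
  obtain ⟨l, hl, hp, hln⟩ := hg
  have hmem : l.length ∈ {n : ℕ | ∃ l : List G, (∀ x ∈ l, x ∈ S ∨ x⁻¹ ∈ S) ∧ l.prod = g ∧
      l.length = n} := ⟨l, hl, hp, rfl⟩
  exact (Nat.sInf_le hmem).trans hln

theorem exists_isWordOfLength {g : G} (hg : g ∈ Subgroup.closure S) :
    ∃ n, IsWordOfLength S n g := by
  induction hg using Subgroup.closure_induction with
  | mem x hx => exact ⟨1, isWordOfLength_one_of_mem hx⟩
  | one => exact ⟨0, isWordOfLength_one 0⟩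
  | mul x y _ _ hx hy =>
    obtain ⟨m, hm⟩ := hx
    obtain ⟨n, hn⟩ := hy
    exact ⟨m + n, hm.mul hn⟩
  | inv x _ hx => exact hx.imp fun n hn => hn.inv

theorem isWordOfLength_wordLength (hS : Subgroup.closure S = ⊤) (g : G) :
    IsWordOfLength S (wordLength S g) g := by
  obtain ⟨n, l, hl, hp, _⟩ := exists_isWordOfLength (hS ▸ Subgroup.mem_top g)
  have hne : {n : ℕ | ∃ l : List G, (∀ x ∈ l, x ∈ S ∨ x⁻¹ ∈ S) ∧ l.prod = g ∧
      l.length = n}.Nonempty := ⟨_, l, hl, hp, rfl⟩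
  obtain ⟨l', hl', hp', hlen⟩ := Nat.sInf_mem hne
  exact ⟨l', hl', hp', hlen.le⟩

/-- The bound solves `ℓ₀ = 1`, `ℓₖ₊₁ = 2 * ℓₖ + 2`. -/
theorem isWordOfLength_of_mem_leftNormedCommutators {k : ℕ} {x : G}
    (hx : x ∈ leftNormedCommutators S k) : IsWordOfLength S (3 * 2 ^ k - 2) x := by
  induction k generalizing x with
  | zero => exact isWordOfLength_one_of_mem hx
  | succ k ih =>
    obtain ⟨y, hy, s, hs, rfl⟩ := hx
    have hy' := ih hy
    have hs' := isWordOfLength_one_of_mem hs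
    refine (((hy'.mul hs').mul hy'.inv).mul hs'.inv).mono ?_
    have : 1 ≤ 2 ^ k := Nat.one_le_two_pow
    rw [pow_succ]
    omega

theorem two_pow_le_nilDetection {k : ℕ} {x : G}
    (hx : x ∈ (⊤ : Subgroup G).lowerCentralSeries k) :
    ((2 ^ (k + 1) : ℕ) : ℕ∞) ≤ nilDetection x := by
  refine le_sInf ?_
  rintro _ ⟨N, hN, hfin, hnil, hxN, rfl⟩
  rw [Nat.cast_le]
  apply Group.two_pow_le_card_of_lowerCentralSeries_ne_bot
  intro hbot
  apply hxN
  have hmem := Subgroup.mem_map_of_mem (QuotientGroup.mk' N) hx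
  rw [Subgroup.map_lowerCentralSeries, ← MonoidHom.range_eq_map,
    MonoidHom.range_eq_top.2 (QuotientGroup.mk'_surjective N), hbot, Subgroup.mem_bot] at hmem
  exact (QuotientGroup.eq_one_iff x).1 hmem

theorem growthLE_nilGrowth_of_not_isNilpotent (hS : Subgroup.closure S = ⊤)
    (hG : ¬ Group.IsNilpotent G) :
    GrowthLE (fun n => (n : ENNReal)) (fun n => (nilGrowth S n : ENNReal)) := by
  -- With `2 ^ k ≤ n < 2 ^ (k + 1)`, a level-`k` commutator has length at most `3 * n` and needs a
  -- quotient of order above `n`.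
  refine ⟨3, fun n hn => ?_⟩
  set k := Nat.log 2 n
  obtain ⟨x, hx, hx1⟩ : ∃ x ∈ leftNormedCommutators S k, x ≠ 1 := by
    by_contra! h
    exact hG (Group.isNilpotent_of_leftNormedCommutators_eq_one hS h)
  have hkn : 2 ^ k ≤ n := Nat.pow_log_le_self 2 (by omega)
  have hnk : n < 2 ^ (k + 1) := Nat.lt_pow_succ_log_self one_lt_two n
  have hlen : wordLength S x ≤ 3 * n :=
    ((isWordOfLength_of_mem_leftNormedCommutators hx).mono (by omega)).wordLength_le
  have hgrow : (n : ℕ∞) ≤ nilGrowth S (3 * n) :=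
    (Nat.cast_le.2 hnk.le).trans <|
      (two_pow_le_nilDetection (leftNormedCommutators_subset_lowerCentralSeries S k hx)).trans <|
        le_iSup₂_of_le x ⟨hx1, hlen⟩ le_rfl
  have hgrow' : (n : ENNReal) ≤ (nilGrowth S (3 * n) : ENNReal) := by
    exact_mod_cast ENat.toENNReal_le.2 hgrow
  refine hgrow'.trans ?_
  exact le_mul_of_one_le_left' (by norm_num)

theorem not_polynomialInLog_of_linear_growthLE {f : ℕ → ENNReal}
    (hf : GrowthLE (fun n => (n : ENNReal)) f) : ¬ PolynomialInLog f := by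
  rintro ⟨d, C₂, h₂⟩
  obtain ⟨C₁, h₁⟩ := hf
  have hC₁ : 1 ≤ C₁ := by
    rcases Nat.eq_zero_or_pos C₁ with rfl | h
    · simpa using h₁ 1 le_rfl
    · exact h
  have hC₂ : 1 ≤ C₂ := by
    rcases Nat.eq_zero_or_pos C₂ with rfl | h
    · have h := (h₁ 1 le_rfl).trans (mul_le_mul_right (h₂ (C₁ * 1) (by omega)) _)
      simp at h
    · exact h
  have hbound : ∀ n : ℕ, 1 ≤ n →
      (n : ℝ) ≤ C₁ * C₂ * Real.log ((C₂ * C₁ : ℕ) * (n : ℝ)) ^ d := by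
    intro n hn
    have h := (h₁ n hn).trans (mul_le_mul_right (h₂ (C₁ * n) (by nlinarith)) _)
    have hlog : 0 ≤ Real.log ((C₂ * C₁ : ℕ) * (n : ℝ)) := by
      exact_mod_cast Real.log_natCast_nonneg (C₂ * C₁ * n)
    have h' : ENNReal.ofReal n ≤
        ENNReal.ofReal (C₁ * C₂ * Real.log ((C₂ * C₁ : ℕ) * (n : ℝ)) ^ d) := by
      rw [ENNReal.ofReal_mul (by positivity), ENNReal.ofReal_mul (by positivity)]
      simp only [ENNReal.ofReal_natCast]
      refine h.trans_eq ?_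
      simp only
      rw [mul_assoc]
      push_cast
      ring_nf
    exact (ENNReal.ofReal_le_ofReal_iff (by positivity)).1 h'
  have hlo := (Real.isLittleO_pow_log_id_atTop (n := d)).comp_tendsto
    ((tendsto_natCast_atTop_atTop (R := ℝ)).const_mul_atTop
      (r := ((C₂ * C₁ : ℕ) : ℝ)) (by exact_mod_cast Nat.mul_pos hC₂ hC₁))
  have hpos : (0 : ℝ) < C₁ * C₂ * (C₂ * C₁ : ℕ) := by positivity
  -- This constant makes the upper bound for `n` equal to `n / 2`.
  have hev := hlo.def (c := 1 / (2 * (C₁ * C₂ * (C₂ * C₁ : ℕ)))) (by positivity)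
  obtain ⟨n, hn, hn1⟩ := (hev.and (Filter.eventually_ge_atTop 1)).exists
  simp only [Function.comp, id, Real.norm_eq_abs] at hn
  have h3 := hbound n hn1
  have h4 := (le_abs_self _).trans hn
  rw [abs_of_nonneg (by positivity : (0 : ℝ) ≤ ((C₂ * C₁ : ℕ) : ℝ) * n)] at h4
  have h5 : (n : ℝ) ≤ C₁ * C₂ * (1 / (2 * (C₁ * C₂ * (C₂ * C₁ : ℕ))) * ((C₂ * C₁ : ℕ) * n)) :=
    h3.trans (mul_le_mul_of_nonneg_left h4 (by positivity))
  have h6 : (C₁ : ℝ) * C₂ * (1 / (2 * (C₁ * C₂ * (C₂ * C₁ : ℕ))) * ((C₂ * C₁ : ℕ) * n)) =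
      n / 2 := by
    field_simp
  rw [h6] at h5
  have : (1 : ℝ) ≤ n := by exact_mod_cast hn1
  linarith

end Growth

/-! ### Central chains and power subgroups. -/

section CentralChains

open scoped commutatorElement

variable {G : Type*} [Group G]

/-- Subgroups obtained from the trivial subgroup by successively adjoining elements which are
central modulo the previous subgroup. -/
inductive CentralChain : Subgroup G → Prop
  | bot : CentralChain ⊥
  | sup_zpowers (K : Subgroup G) (t : G) :
      CentralChain K → (∀ g, ⁅t, g⁆ ∈ K) → CentralChain (K ⊔ Subgroup.zpowers t)

theorem Subgroup.mem_sup_zpowers {K : Subgroup G} [K.Normal] {t x : G} :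
    x ∈ K ⊔ Subgroup.zpowers t ↔ ∃ h ∈ K, ∃ i : ℤ, h * t ^ i = x := by
  rw [Subgroup.mem_sup_of_normal_left]
  constructor
  · rintro ⟨h, hh, _, ⟨i, rfl⟩, rfl⟩
    exact ⟨h, hh, i, rfl⟩
  · rintro ⟨h, hh, i, rfl⟩
    exact ⟨h, hh, _, ⟨i, rfl⟩, rfl⟩

theorem CentralChain.normal {K : Subgroup G} (hK : CentralChain K) : K.Normal := by
  induction hK with
  | bot => infer_instance
  | sup_zpowers K t _ ht ih =>
    refine ⟨fun x hx g => ?_⟩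
    obtain ⟨h, hh, i, rfl⟩ := Subgroup.mem_sup_zpowers.1 hx
    have h1 : g * h * g⁻¹ ∈ K ⊔ Subgroup.zpowers t := le_sup_left (a := K) (ih.conj_mem h hh g)
    have ht' : t ∈ K ⊔ Subgroup.zpowers t := le_sup_right (a := K) (Subgroup.mem_zpowers t)
    have h2 : g * t * g⁻¹ ∈ K ⊔ Subgroup.zpowers t := by
      have := mul_mem (inv_mem (le_sup_left (b := Subgroup.zpowers t) (ht g))) ht'
      simpa [commutatorElement_def, mul_assoc] using this
    have h3 := mul_mem h1 (zpow_mem h2 i)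
    rw [conj_zpow] at h3
    simpa [mul_assoc] using h3

theorem CentralChain.sup_closure {K : Subgroup G} (hK : CentralChain K) {F : Set G}
    (hF : F.Finite) (hc : ∀ f ∈ F, ∀ g, ⁅f, g⁆ ∈ K) : CentralChain (K ⊔ Subgroup.closure F) := by
  induction F, hF using Set.Finite.induction_on with
  | empty => simpa using hK
  | @insert a F _ _ ih =>
    have h1 := CentralChain.sup_zpowers _ a (ih fun f hf => hc f (Set.mem_insert_of_mem a hf))
      fun g => le_sup_left (a := K) (hc a (Set.mem_insert a F) g)
    rwa [sup_assoc, Subgroup.zpowers_eq_closure, ← Subgroup.closure_union, Set.union_comm,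
      ← Set.insert_eq] at h1

theorem Subgroup.mk_mem_center_iff {N : Subgroup G} [N.Normal] {x : G} :
    (x : G ⧸ N) ∈ Subgroup.center (G ⧸ N) ↔ ∀ g, ⁅x, g⁆ ∈ N := by
  rw [Subgroup.mem_center_iff, (QuotientGroup.mk_surjective (s := N)).forall]
  refine forall_congr' fun g => ?_
  rw [← QuotientGroup.eq_one_iff]
  change _ ↔ ((QuotientGroup.mk' N) ⁅x, g⁆) = 1
  rw [map_commutatorElement, commutatorElement_eq_one_iff_mul_comm]
  exact eq_comm

/-- In the inductive step, let `N` be the right-hand side at level `k + 1`. Modulo `N`, level `k` of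
the series becomes central: by induction it is generated by level `k + 1`, whose brackets lie in
level `k + 2`, and by commutators whose brackets with `S` lie in `N`. So level `k + 1` is contained
in `N`. -/
theorem lowerCentralSeries_le_succ_sup_closure {S : Set G} (hS : Subgroup.closure S = ⊤) (k : ℕ) :
    (⊤ : Subgroup G).lowerCentralSeries k ≤
      (⊤ : Subgroup G).lowerCentralSeries (k + 1) ⊔
        Subgroup.closure (leftNormedCommutators S k) := by
  induction k with
  | zero =>
    change _ ≤ _ ⊔ Subgroup.closure S
    rw [hS]
    simp
  | succ k ih =>
    set N := (⊤ : Subgroup G).lowerCentralSeries (k + 2) ⊔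
        Subgroup.closure (leftNormedCommutators S (k + 1)) with hN
    have hNle : N ≤ (⊤ : Subgroup G).lowerCentralSeries (k + 1) :=
      sup_le (Subgroup.lowerCentralSeries_antitone _ (Nat.le_succ _))
        ((Subgroup.closure_le _).2 (leftNormedCommutators_subset_lowerCentralSeries S (k + 1)))
    have hcomm : ∀ y ∈ (⊤ : Subgroup G).lowerCentralSeries (k + 1), ∀ g, ⁅y, g⁆ ∈ N :=
      fun y hy g => le_sup_left (a := (⊤ : Subgroup G).lowerCentralSeries (k + 2))
        (Subgroup.commutator_mem_commutator hy (Subgroup.mem_top g))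
    have hnormal : N.Normal := by
      refine ⟨fun x hx g => ?_⟩
      have := mul_mem (inv_mem (hcomm x (hNle hx) g)) hx
      simpa [commutatorElement_def, mul_assoc] using this
    have hcenter : (⊤ : Subgroup G).lowerCentralSeries k ≤
        (Subgroup.center (G ⧸ N)).comap (QuotientGroup.mk' N) := by
      refine ih.trans (sup_le (fun y hy => ?_) ((Subgroup.closure_le _).2 fun y hy => ?_))
      · exact Subgroup.mk_mem_center_iff.2 (hcomm y hy)
      · refine Subgroup.mem_center_of_commute_generators (S := QuotientGroup.mk' N '' S) ?_ ?_
        · rw [← MonoidHom.map_closure, hS, ← MonoidHom.range_eq_map, MonoidHom.range_eq_top]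
          exact QuotientGroup.mk'_surjective _
        · rintro _ ⟨s, hs, rfl⟩
          rw [← commutatorElement_eq_one_iff_commute, ← map_commutatorElement]
          refine (QuotientGroup.eq_one_iff _).2 ?_
          exact le_sup_right (a := (⊤ : Subgroup G).lowerCentralSeries (k + 2))
            (Subgroup.subset_closure ⟨y, hy, s, hs, rfl⟩)
    rw [Subgroup.lowerCentralSeries_succ, Subgroup.commutator_le]
    exact fun x hx g _ => Subgroup.mk_mem_center_iff.1 (hcenter hx) g

/-- Climb the lower central series from the bottom, adjoining at each level its finitely many
left-normed commutators. -/
theorem centralChain_top [Group.IsNilpotent G] {S : Set G} (hfin : S.Finite)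
    (hS : Subgroup.closure S = ⊤) : CentralChain (⊤ : Subgroup G) := by
  obtain ⟨c, hc⟩ := Subgroup.nilpotent_iff_lowerCentralSeries.1 ‹Group.IsNilpotent G›
  have key : ∀ i j, i + j = c → CentralChain ((⊤ : Subgroup G).lowerCentralSeries j) := by
    intro i
    induction i with
    | zero =>
      rintro j rfl
      rw [zero_add] at hc
      rw [hc]
      exact CentralChain.bot
    | succ i ih =>
      intro j hj
      have h := (ih (j + 1) (by omega)).sup_closure (leftNormedCommutators_finite hfin j)
        fun f hf g => Subgroup.commutator_mem_commutator
          (leftNormedCommutators_subset_lowerCentralSeries S j hf) (Subgroup.mem_top g)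
      rwa [le_antisymm (sup_le (Subgroup.lowerCentralSeries_antitone _ (Nat.le_succ j))
        ((Subgroup.closure_le _).2 (leftNormedCommutators_subset_lowerCentralSeries S j)))
        (lowerCentralSeries_le_succ_sup_closure hS j)] at h
  exact key c 0 (add_zero c)

/-- The subgroup generated by the `e`-th powers of elements of `K`. -/
def powerSubgroup (K : Subgroup G) (e : ℕ) : Subgroup G :=
  Subgroup.closure ((fun x => x ^ e) '' (K : Set G))

theorem powerSubgroup_le {K H : Subgroup G} {e : ℕ} :
    powerSubgroup K e ≤ H ↔ ∀ x ∈ K, x ^ e ∈ H := by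
  simp [powerSubgroup, Subgroup.closure_le, Set.subset_def]

theorem pow_mem_powerSubgroup {K : Subgroup G} {x : G} (hx : x ∈ K) (e : ℕ) :
    x ^ e ∈ powerSubgroup K e :=
  powerSubgroup_le.1 le_rfl x hx

theorem powerSubgroup_le_self (K : Subgroup G) (e : ℕ) : powerSubgroup K e ≤ K :=
  powerSubgroup_le.2 fun _ hx => pow_mem hx e

theorem powerSubgroup_mono {K H : Subgroup G} (h : K ≤ H) (e : ℕ) :
    powerSubgroup K e ≤ powerSubgroup H e :=
  powerSubgroup_le.2 fun _ hx => pow_mem_powerSubgroup (h hx) e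

theorem powerSubgroup_le_of_dvd (K : Subgroup G) {d e : ℕ} (h : d ∣ e) :
    powerSubgroup K e ≤ powerSubgroup K d := by
  obtain ⟨m, rfl⟩ := h
  refine powerSubgroup_le.2 fun x hx => ?_
  rw [pow_mul]
  exact pow_mem (pow_mem_powerSubgroup hx d) m

instance powerSubgroup_normal (K : Subgroup G) [hK : K.Normal] (e : ℕ) :
    (powerSubgroup K e).Normal := by
  refine ⟨fun x hx g => ?_⟩
  have hle : powerSubgroup K e ≤ (powerSubgroup K e).comap (MulAut.conj g).toMonoidHom := by
    refine powerSubgroup_le.2 fun y hy => ?_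
    have := pow_mem_powerSubgroup (hK.conj_mem y hy g) e
    rw [conj_pow] at this
    exact this
  exact hle hx

theorem Subgroup.exists_mul_zpow_pow {K : Subgroup G} [K.Normal] {h : G} (hh : h ∈ K) (t : G)
    (i : ℤ) (n : ℕ) : ∃ h' ∈ K, (h * t ^ i) ^ n = h' * t ^ (i * n) := by
  refine ⟨(h * t ^ i) ^ n * (t ^ (i * n))⁻¹, ?_, by group⟩
  rw [← QuotientGroup.eq_one_iff]
  simp [(QuotientGroup.eq_one_iff h).2 hh, zpow_mul]

/-- Put `s = t ^ e ^ i`. Conjugation by `h` takes `⁅h⁻¹, s⁆ * s` to `s`. The bracket is one level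
deeper, so by induction it commutes with `s` modulo `e`-th powers; raising to the power `e` kills it
and leaves `s ^ e` fixed by `h`. -/
theorem commute_mk_pow_of_mem_lowerCentralSeries {K : Subgroup G} [hK : K.Normal] (t : G) (e : ℕ)
    {c : ℕ} (hc : (⊤ : Subgroup G).lowerCentralSeries c = ⊥) (i : ℕ) {j : ℕ} (hij : i + j = c)
    {h : G} (hh : h ∈ K) (hhj : h ∈ (⊤ : Subgroup G).lowerCentralSeries j) :
    Commute ((t ^ e ^ i : G) : G ⧸ powerSubgroup K e) (h : G ⧸ powerSubgroup K e) := by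
  induction i generalizing j h with
  | zero =>
    rw [zero_add] at hij
    rw [hij, hc, Subgroup.mem_bot] at hhj
    rw [hhj]
    exact Commute.one_right _
  | succ i ih =>
    set s := t ^ e ^ i
    have hy : ⁅h⁻¹, s⁆ ∈ (⊤ : Subgroup G).lowerCentralSeries (j + 1) :=
      Subgroup.commutator_mem_commutator (inv_mem hhj) (Subgroup.mem_top s)
    have hyK : ⁅h⁻¹, s⁆ ∈ K := by
      have := mul_mem (inv_mem hh) (hK.conj_mem h hh s)
      simpa [commutatorElement_def, mul_assoc] using this
    have hcomm := ih (by omega) hyK hy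
    have hsemi : SemiconjBy (h : G ⧸ powerSubgroup K e)
        ((⁅h⁻¹, s⁆ : G) * (s : G ⧸ powerSubgroup K e)) (s : G ⧸ powerSubgroup K e) := by
      have : h * (⁅h⁻¹, s⁆ * s) = s * h := by simp [commutatorElement_def, mul_assoc]
      exact congrArg (QuotientGroup.mk (s := powerSubgroup K e)) this
    have hpow := hsemi.pow_right e
    have hye : ((⁅h⁻¹, s⁆ : G) : G ⧸ powerSubgroup K e) ^ e = 1 :=
      (QuotientGroup.eq_one_iff _).2 (pow_mem_powerSubgroup hyK e)
    rw [hcomm.symm.mul_pow, hye, one_mul] at hpow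
    rw [pow_succ, pow_mul]
    exact Commute.symm hpow

theorem powerSubgroup_sup_zpowers_inf_le_of_infinite [Group.IsNilpotent G] (K : Subgroup G)
    [K.Normal] (t : G) (hinf : ∀ i : ℤ, t ^ i ∈ K → i = 0) :
    ∃ c, ∀ e, 1 ≤ e →
      powerSubgroup (K ⊔ Subgroup.zpowers t) (e ^ (c + 1)) ⊓ K ≤ powerSubgroup K e := by
  obtain ⟨c, hc⟩ := Subgroup.nilpotent_iff_lowerCentralSeries.1 ‹Group.IsNilpotent G›
  refine ⟨c, fun e he => ?_⟩
  have hcomm : ∀ h ∈ K, Commute ((t ^ e ^ c : G) : G ⧸ powerSubgroup K e) h := fun h hh =>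
    commute_mk_pow_of_mem_lowerCentralSeries t e hc c (add_zero c) hh (Subgroup.mem_top h)
  -- The power `e ^ c` turns `h * t ^ i` into `h'` times a power of `t ^ e ^ c`. These factors
  -- commute modulo `powerSubgroup K e`, so a further `e`-th power removes `h'`. Only powers of `t ^
  -- e ^ c` remain, and just the trivial one lies in `K`.
  have hle : powerSubgroup (K ⊔ Subgroup.zpowers t) (e ^ (c + 1)) ≤
      (Subgroup.zpowers ((t ^ e ^ c : G) : G ⧸ powerSubgroup K e)).comap
        (QuotientGroup.mk' (powerSubgroup K e)) := by
    refine powerSubgroup_le.2 fun x hx => ?_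
    obtain ⟨h, hh, i, rfl⟩ := Subgroup.mem_sup_zpowers.1 hx
    obtain ⟨h', hh', hpow⟩ := Subgroup.exists_mul_zpow_pow hh t i (e ^ c)
    rw [pow_succ, pow_mul, hpow, mul_comm i, zpow_mul, zpow_natCast, Subgroup.mem_comap, map_pow,
      map_mul, map_zpow]
    have h1 : (QuotientGroup.mk' (powerSubgroup K e) h') ^ e = 1 :=
      (QuotientGroup.eq_one_iff _).2 (pow_mem_powerSubgroup hh' e)
    have h2 : Commute (QuotientGroup.mk' (powerSubgroup K e) h')
      (QuotientGroup.mk' (powerSubgroup K e) (t ^ e ^ c) ^ i) := (hcomm h' hh').symm.zpow_right i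
    rw [h2.mul_pow, h1, one_mul]
    exact pow_mem (zpow_mem (Subgroup.mem_zpowers _) i) e
  rintro y ⟨hy, hyK⟩
  obtain ⟨j, hj⟩ := hle hy
  have hj' : ((t ^ e ^ c : G) ^ j)⁻¹ * y ∈ powerSubgroup K e := QuotientGroup.eq.1 hj
  have h3 : t ^ (((e ^ c : ℕ) : ℤ) * j) ∈ K := by
    have := mul_mem hyK (K.inv_mem (powerSubgroup_le_self K e hj'))
    rw [zpow_mul, zpow_natCast]
    simpa using this
  have h4 := hinf _ h3
  have h5 : j = 0 := by
    rcases mul_eq_zero.1 h4 with h | h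
    · exact absurd h (by positivity)
    · exact h
  simpa [h5] using hj'

/-- If `t` has infinite order modulo `K`, take `r = 1`: `q`-th powers have `t`-exponent divisible by
`q`. Otherwise take `r` with `t ^ r ∈ K`, so that all `r`-th powers fall into `K`. -/
theorem exists_powerSubgroup_sup_zpowers [Group.IsNilpotent G] (K : Subgroup G) [K.Normal] (t : G) :
    ∃ r c : ℕ, 1 ≤ r ∧
      (∀ e, 1 ≤ e →
        powerSubgroup (K ⊔ Subgroup.zpowers t) (r * e ^ (c + 1)) ⊓ K ≤ powerSubgroup K e) ∧
      ∀ q : ℕ, ∀ h ∈ K, ∀ i : ℤ, h * t ^ i ∉ K → ¬ (q : ℤ) ∣ i →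
        h * t ^ i ∉ powerSubgroup (K ⊔ Subgroup.zpowers t) (r * q) := by
  by_cases hfin : ∀ i : ℤ, t ^ i ∈ K → i = 0
  · obtain ⟨c, hc⟩ := powerSubgroup_sup_zpowers_inf_le_of_infinite K t hfin
    refine ⟨1, c, le_rfl, by simpa using hc, fun q h hh i _ hqi hmem => hqi ?_⟩
    have hle : powerSubgroup (K ⊔ Subgroup.zpowers t) (1 * q) ≤ K ⊔ Subgroup.zpowers (t ^ q) := by
      refine powerSubgroup_le.2 fun x hx => ?_
      obtain ⟨h, hh, i, rfl⟩ := Subgroup.mem_sup_zpowers.1 hx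
      obtain ⟨h', hh', hpow⟩ := Subgroup.exists_mul_zpow_pow hh t i (1 * q)
      rw [hpow]
      exact Subgroup.mem_sup_zpowers.2 ⟨h', hh', i, by rw [mul_comm i, zpow_mul]; simp⟩
    obtain ⟨h', hh', j, hj⟩ := Subgroup.mem_sup_zpowers.1 (hle hmem)
    have h1 : t ^ (i - q * j) ∈ K := by
      have := mul_mem (inv_mem hh) hh'
      rwa [show h⁻¹ * h' = t ^ (i - q * j) by
        rw [zpow_sub, zpow_mul, zpow_natCast, eq_mul_inv_iff_mul_eq, mul_assoc, hj,
          inv_mul_cancel_left]] at this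
    exact ⟨j, by have := hfin _ h1; omega⟩
  · push Not at hfin
    obtain ⟨i, hi, hi0⟩ := hfin
    have htr : t ^ i.natAbs ∈ K := by
      rcases Int.natAbs_eq i with h | h
      · rw [h, zpow_natCast] at hi
        exact hi
      · rw [h, zpow_neg, zpow_natCast] at hi
        exact inv_mem_iff.1 hi
    have hpowK : ∀ x ∈ K ⊔ Subgroup.zpowers t, x ^ i.natAbs ∈ K := by
      intro x hx
      obtain ⟨h, hh, j, rfl⟩ := Subgroup.mem_sup_zpowers.1 hx
      obtain ⟨h', hh', hpow⟩ := Subgroup.exists_mul_zpow_pow hh t j i.natAbs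
      rw [hpow, mul_comm j, zpow_mul, zpow_natCast]
      exact mul_mem hh' (zpow_mem htr j)
    refine ⟨i.natAbs, 0, Int.natAbs_pos.2 hi0, fun e _ => ?_, fun q h hh j hK _ hmem => hK ?_⟩
    · refine inf_le_left.trans (powerSubgroup_le.2 fun x hx => ?_)
      rw [zero_add, pow_one, pow_mul]
      exact pow_mem_powerSubgroup (hpowK x hx) e
    · exact (powerSubgroup_le_of_dvd _ (Dvd.intro q rfl)).trans (powerSubgroup_le.2 hpowK) hmem

/-- Factor the index through `K ⊔ P`. The upper factor is at most `e`, since `1, t, …, t ^ (e - 1)`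
meet every coset; the lower one is bounded by the index in `K`. A nonzero `relIndex` expresses
finiteness. -/
theorem powerSubgroup_relIndex_sup_zpowers {K : Subgroup G} [K.Normal] {t : G}
    (hn : (K ⊔ Subgroup.zpowers t).Normal) {e : ℕ}
    (he : 1 ≤ e) (hK : (powerSubgroup K e).relIndex K ≠ 0) :
    (powerSubgroup (K ⊔ Subgroup.zpowers t) e).relIndex (K ⊔ Subgroup.zpowers t) ≠ 0 ∧
    (powerSubgroup (K ⊔ Subgroup.zpowers t) e).relIndex (K ⊔ Subgroup.zpowers t) ≤
      e * (powerSubgroup K e).relIndex K := by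
  set K' := K ⊔ Subgroup.zpowers t
  set P := powerSubgroup K' e with hP
  have hKK' : K ≤ K' := le_sup_left
  have htK' : t ∈ K' := le_sup_right (a := K) (Subgroup.mem_zpowers t)
  have hmul := Subgroup.relIndex_mul_relIndex P (K ⊔ P) K' le_sup_right
    (sup_le hKK' (powerSubgroup_le_self K' e))
  rw [Subgroup.relIndex_sup_right] at hmul
  have h1 : P.relIndex K ≤ (powerSubgroup K e).relIndex K :=
    Subgroup.relIndex_le_of_le_left (powerSubgroup_mono hKK' e) hK
  have h10 : P.relIndex K ≠ 0 := fun h0 =>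
    hK (Subgroup.relIndex_eq_zero_of_le_left (powerSubgroup_mono hKK' e) h0)
  have hsurj : Function.Surjective (fun a : Fin e =>
      (QuotientGroup.mk ⟨t ^ (a : ℕ), pow_mem htK' _⟩ : K' ⧸ (K ⊔ P).subgroupOf K')) := by
    intro x
    obtain ⟨⟨x, hx⟩, rfl⟩ := QuotientGroup.mk_surjective x
    obtain ⟨h, hh, i, rfl⟩ := Subgroup.mem_sup_zpowers.1 hx
    have hpos : (0 : ℤ) < e := by exact_mod_cast he
    refine ⟨⟨(i % e).toNat, ?_⟩, ?_⟩
    · have := Int.emod_lt_of_pos i hpos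
      omega
    · rw [QuotientGroup.eq, Subgroup.mem_subgroupOf]
      have hti : t ^ i = t ^ (i % e).toNat * (t ^ e) ^ (i / e) := by
        conv_lhs => rw [← Int.emod_add_mul_ediv i e]
        rw [zpow_add, zpow_mul, zpow_natCast, ← zpow_natCast t (i % e).toNat,
          Int.toNat_of_nonneg (Int.emod_nonneg i hpos.ne')]
      have hsplit : (t ^ (i % e).toNat)⁻¹ * (h * t ^ i) =
          ((t ^ (i % e).toNat)⁻¹ * h * ((t ^ (i % e).toNat)⁻¹)⁻¹) * (t ^ e) ^ (i / e) := by
        rw [hti]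
        group
      change (t ^ (i % e).toNat)⁻¹ * (h * t ^ i) ∈ K ⊔ P
      rw [hsplit]
      exact mul_mem (le_sup_left (a := K) (Subgroup.Normal.conj_mem ‹K.Normal› h hh _))
        (zpow_mem (le_sup_right (a := K) (pow_mem_powerSubgroup htK' e)) _)
  have : Finite (K' ⧸ (K ⊔ P).subgroupOf K') := Finite.of_surjective _ hsurj
  have h2 : (K ⊔ P).relIndex K' ≤ e := by
    have := Nat.card_le_card_of_surjective _ hsurj
    rw [Nat.card_fin] at this
    exact this
  have h20 : (K ⊔ P).relIndex K' ≠ 0 := Subgroup.index_ne_zero_of_finite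
  rw [← hmul]
  exact ⟨mul_ne_zero h10 h20, by rw [mul_comm]; exact Nat.mul_le_mul h2 h1⟩

end CentralChains

/-! ### Polynomial distortion, separation and the upper bound. -/

section PolynomialDistortion

open scoped commutatorElement

variable {G : Type*} [Group G]

theorem Set.Finite.exists_uniform_nat {α : Type*} {F : Set α} (hF : F.Finite)
    {P : α → ℕ → Prop} (hmono : ∀ a m n, m ≤ n → P a m → P a n) (h : ∀ a ∈ F, ∃ n, P a n) :
    ∃ n, ∀ a ∈ F, P a n := by
  induction F, hF using Set.Finite.induction_on with
  | empty => exact ⟨0, by simp⟩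
  | @insert a F _ _ ih =>
    obtain ⟨n, hn⟩ := ih fun b hb => h b (Set.mem_insert_of_mem a hb)
    obtain ⟨m, hm⟩ := h a (Set.mem_insert a F)
    refine ⟨max m n, ?_⟩
    rintro b (rfl | hb)
    · exact hmono _ _ _ (le_max_left m n) hm
    · exact hmono _ _ _ (le_max_right m n) (hn b hb)

theorem add_two_pow_add_le (n k w : ℕ) :
    (n + 2) ^ (k + 1 + w) + (n + 2) ^ k ≤ (n + 3) ^ (k + 1 + w) := by
  have h1 : (n + 2) ^ k ≤ (n + 2) ^ (k + w) := Nat.pow_le_pow_right (by omega) (by omega)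
  have h2 : (n + 2) ^ (k + w) ≤ (n + 3) ^ (k + w) := Nat.pow_le_pow_left (by omega) _
  rw [show k + 1 + w = k + w + 1 by ring, pow_succ, pow_succ]
  nlinarith

/-- Passing from `u ^ n` to `u ^ (n + 1)` multiplies the conjugate of `s` by that of `⁅s⁻¹, u⁆`,
which is deeper in the lower central series and so polynomially short by induction. -/
theorem exists_isWordOfLength_conj_pow {K : Subgroup G} [hK : K.Normal] {B : Set G}
    (hB : Subgroup.closure B = K) (u : G) {c : ℕ}
    (hc : (⊤ : Subgroup G).lowerCentralSeries c = ⊥) (i : ℕ) {j : ℕ} (hij : i + j = c) {s : G}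
    (hs : s ∈ K) (hsj : s ∈ (⊤ : Subgroup G).lowerCentralSeries j) :
    ∃ k, ∀ n : ℕ, IsWordOfLength B ((n + 2) ^ k) (u ^ n * s * (u ^ n)⁻¹) := by
  induction i generalizing j s with
  | zero =>
    rw [zero_add] at hij
    rw [hij, hc, Subgroup.mem_bot] at hsj
    refine ⟨0, fun n => ?_⟩
    simpa [hsj] using isWordOfLength_one 1
  | succ i ih =>
    have hv : ⁅s⁻¹, u⁆ ∈ (⊤ : Subgroup G).lowerCentralSeries (j + 1) :=
      Subgroup.commutator_mem_commutator (inv_mem hsj) (Subgroup.mem_top u)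
    have hvK : ⁅s⁻¹, u⁆ ∈ K := by
      have := mul_mem (inv_mem hs) (hK.conj_mem s hs u)
      simpa [commutatorElement_def, mul_assoc] using this
    obtain ⟨k, hk⟩ := ih (by omega) hvK hv
    obtain ⟨w, hw⟩ := exists_isWordOfLength (hB ▸ hs : s ∈ Subgroup.closure B)
    -- Summing over `n` costs one degree; `w` absorbs the length of `s` itself, as `w < 2 ^ w`.
    refine ⟨k + 1 + w, fun n => ?_⟩
    induction n with
    | zero =>
      simp only [pow_zero, one_mul, inv_one, mul_one]
      refine hw.mono (Nat.lt_two_pow_self.le.trans ?_)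
      exact Nat.pow_le_pow_right (by omega) (by omega)
    | succ n ihn =>
      have h := (ihn.mul (hk n)).mono (add_two_pow_add_le n k w)
      have heq : u ^ n * s * (u ^ n)⁻¹ * (u ^ n * ⁅s⁻¹, u⁆ * (u ^ n)⁻¹) =
          u ^ (n + 1) * s * (u ^ (n + 1))⁻¹ := by
        rw [commutatorElement_def, pow_succ]
        group
      rwa [heq] at h

theorem exists_isWordOfLength_conj_zpow [Group.IsNilpotent G] {K : Subgroup G} [K.Normal]
    {B : Set G} (hfin : B.Finite) (hB : Subgroup.closure B = K) (t : G) :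
    ∃ k, ∀ s ∈ B, ∀ i : ℤ, IsWordOfLength B ((i.natAbs + 2) ^ k) (t ^ i * s * (t ^ i)⁻¹) := by
  obtain ⟨c, hc⟩ := Subgroup.nilpotent_iff_lowerCentralSeries.1 ‹Group.IsNilpotent G›
  refine hfin.exists_uniform_nat
    (fun s m n hmn h i => (h i).mono (Nat.pow_le_pow_right (by omega) hmn)) fun s hs => ?_
  have hsK : s ∈ K := hB ▸ Subgroup.subset_closure hs
  obtain ⟨k₁, h₁⟩ := exists_isWordOfLength_conj_pow hB t hc c (add_zero c) hsK
    (Subgroup.mem_top s)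
  obtain ⟨k₂, h₂⟩ := exists_isWordOfLength_conj_pow hB t⁻¹ hc c (add_zero c) hsK
    (Subgroup.mem_top s)
  refine ⟨max k₁ k₂, fun i => ?_⟩
  rcases Int.natAbs_eq i with h | h
  · rw [h, zpow_natCast, Int.natAbs_natCast]
    exact (h₁ _).mono (Nat.pow_le_pow_right (by omega) (le_max_left _ _))
  · rw [h, zpow_neg, zpow_natCast, Int.natAbs_neg, Int.natAbs_natCast, ← inv_pow]
    exact (h₂ _).mono (Nat.pow_le_pow_right (by omega) (le_max_right _ _))

/-- Collect the letters `t` on the right: moving a letter `x` of `B` past `t ^ i` replaces it by a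
conjugate of polynomial length. -/
theorem exists_mul_zpow_of_isWordOfLength_insert [Group.IsNilpotent G] {K : Subgroup G} [K.Normal]
    {B : Set G} (hfin : B.Finite) (hB : Subgroup.closure B = K) (t : G) :
    ∃ k, ∀ n g, IsWordOfLength (insert t B) n g → ∃ i : ℤ, i.natAbs ≤ n ∧
      ∃ h, IsWordOfLength B (n * (n + 2) ^ k) h ∧ g = h * t ^ i := by
  obtain ⟨k, hk⟩ := exists_isWordOfLength_conj_zpow hfin hB t
  have hk' : ∀ x, x ∈ B ∨ x⁻¹ ∈ B → ∀ i : ℤ,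
      IsWordOfLength B ((i.natAbs + 2) ^ k) (t ^ i * x * (t ^ i)⁻¹) := by
    rintro x (hx | hx) i
    · exact hk x hx i
    · simpa [mul_assoc] using (hk _ hx i).inv
  refine ⟨k, ?_⟩
  rintro n g ⟨l, hl, rfl, hln⟩
  suffices ∃ i : ℤ, i.natAbs ≤ l.length ∧
      ∃ h, IsWordOfLength B (l.length * (l.length + 2) ^ k) h ∧ l.prod = h * t ^ i by
    obtain ⟨i, hi, h, hh, hp⟩ := this
    exact ⟨i, hi.trans hln, h, hh.mono (Nat.mul_le_mul hln
      (Nat.pow_le_pow_left (by omega) k)), hp⟩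
  clear hln
  induction l using List.reverseRecOn with
  | nil => exact ⟨0, by simp, 1, isWordOfLength_one _, by simp⟩
  | append_singleton l x ih =>
    obtain ⟨i, hi, h, hh, hp⟩ := ih fun y hy => hl y (by simp [hy])
    have hlen : l.length * (l.length + 2) ^ k + (i.natAbs + 2) ^ k ≤
        (l ++ [x]).length * ((l ++ [x]).length + 2) ^ k := by
      have h1 : (i.natAbs + 2) ^ k ≤ (l.length + 1 + 2) ^ k := Nat.pow_le_pow_left (by omega) k
      have h2 : (l.length + 2) ^ k ≤ (l.length + 1 + 2) ^ k := Nat.pow_le_pow_left (by omega) k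
      simp only [List.length_append, List.length_singleton]
      nlinarith
    have hlen' := (Nat.le_add_right _ _).trans hlen
    rw [List.prod_append, List.prod_singleton, hp]
    have hx := hl x (by simp)
    by_cases hxB : x ∈ B ∨ x⁻¹ ∈ B
    · refine ⟨i, by simp; omega, h * (t ^ i * x * (t ^ i)⁻¹),
        (hh.mul (hk' x hxB i)).mono hlen, by group⟩
    · push Not at hxB
      rcases hx with hx | hx
      · obtain rfl := hx.resolve_right hxB.1
        refine ⟨i + 1, by simp; omega, h, hh.mono hlen', by rw [zpow_add_one, mul_assoc]⟩
      · have hxt : x = t⁻¹ := inv_eq_iff_eq_inv.1 (hx.resolve_right hxB.2)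
        refine ⟨i - 1, by simp; omega, h, hh.mono hlen', by rw [hxt, zpow_sub_one, mul_assoc]⟩

/-- The exponents `i` with `t ^ i ∈ K` form a subgroup `rℤ`, so a single word for `t ^ r` suffices.
-/
theorem exists_isWordOfLength_zpow {K : Subgroup G} {B : Set G} (hB : Subgroup.closure B = K)
    (t : G) : ∃ w, ∀ i : ℤ, t ^ i ∈ K → IsWordOfLength B (i.natAbs * w) (t ^ i) := by
  let H : AddSubgroup ℤ :=
    { carrier := {i | t ^ i ∈ K}
      zero_mem' := by simp
      add_mem' := fun {i j} hi hj => by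
        change t ^ (i + j) ∈ K
        rw [zpow_add]
        exact mul_mem hi hj
      neg_mem' := fun {i} hi => by
        change t ^ (-i) ∈ K
        rw [zpow_neg]
        exact inv_mem hi }
  obtain ⟨r, hr⟩ := Int.subgroup_cyclic H
  rw [← AddSubgroup.zmultiples_eq_closure] at hr
  have hrK : t ^ r ∈ K := by
    have : r ∈ H := hr ▸ AddSubgroup.mem_zmultiples r
    exact this
  obtain ⟨w, hw⟩ := exists_isWordOfLength (hB ▸ hrK : t ^ r ∈ Subgroup.closure B)
  refine ⟨w, fun i hi => ?_⟩
  have hiH : i ∈ H := hi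
  rw [hr, Int.mem_zmultiples_iff] at hiH
  obtain ⟨j, rfl⟩ := hiH
  by_cases hr0 : r = 0
  · simpa [hr0] using isWordOfLength_one 0
  · rw [zpow_mul]
    refine (hw.zpow j).mono (Nat.mul_le_mul_right w ?_)
    rw [Int.natAbs_mul]
    exact Nat.le_mul_of_pos_left _ (Int.natAbs_pos.2 hr0)

theorem exists_isWordOfLength_of_mem_of_insert [Group.IsNilpotent G] {K : Subgroup G} [K.Normal]
    {B : Set G} (hfin : B.Finite) (hB : Subgroup.closure B = K) (t : G) :
    ∃ k, ∀ n g, IsWordOfLength (insert t B) n g →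
      (g ∈ K → IsWordOfLength B ((n + 2) ^ k) g) ∧
      (g ∉ K → ∃ h ∈ K, ∃ i : ℤ, i ≠ 0 ∧ i.natAbs ≤ n ∧ g = h * t ^ i) := by
  obtain ⟨k, hk⟩ := exists_mul_zpow_of_isWordOfLength_insert hfin hB t
  obtain ⟨w, hw⟩ := exists_isWordOfLength_zpow hB t
  refine ⟨k + 1 + w, fun n g hg => ?_⟩
  obtain ⟨i, hi, h, hh, rfl⟩ := hk n g hg
  have hhK : h ∈ K := hB ▸ hh.mem_closure
  constructor
  · intro hgK
    refine (hh.mul (hw i ((K.mul_mem_cancel_left hhK).1 hgK))).mono ?_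
    have h1 : w + 1 ≤ (n + 2) ^ w :=
      Nat.lt_two_pow_self.trans_le (Nat.pow_le_pow_left (by omega) w)
    have h2 : 1 ≤ (n + 2) ^ k := Nat.one_le_pow _ _ (by omega)
    calc n * (n + 2) ^ k + i.natAbs * w ≤ n * (n + 2) ^ k + n * w := by gcongr
      _ ≤ (n + 2) ^ k * (n + 2) * (w + 1) := by nlinarith [Nat.zero_le (n * w), mul_le_mul_right h2 (n * w)]
      _ ≤ (n + 2) ^ k * (n + 2) * (n + 2) ^ w := by gcongr
      _ = (n + 2) ^ (k + 1 + w) := by ring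
  · intro hgK
    refine ⟨h, hhK, i, ?_, hi, rfl⟩
    rintro rfl
    exact hgK (by simpa using hhK)

/-- A quantitative form of residual finiteness along a central chain: there are generators for which
every nontrivial element of length `n` avoids the power subgroups whose exponents come from
non-divisors of an integer that is polynomially bounded in `n`. -/
theorem CentralChain.exists_separation [Group.IsNilpotent G] {K : Subgroup G}
    (hK : CentralChain K) :
    ∃ B : Set G, B.Finite ∧ Subgroup.closure B = K ∧ ∃ k m D l : ℕ, 1 ≤ m ∧ 1 ≤ D ∧
      (∀ n g, IsWordOfLength B n g → g ≠ 1 → ∃ a, 1 ≤ a ∧ a ≤ (n + 2) ^ k ∧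
        ∀ q, 1 ≤ q → ¬ q ∣ a → g ∉ powerSubgroup K (m * q ^ D)) ∧
      ∀ e, 1 ≤ e → (powerSubgroup K e).relIndex K ≠ 0 ∧ (powerSubgroup K e).relIndex K ≤ e ^ l := by
  induction hK with
  | bot =>
    refine ⟨∅, Set.finite_empty, Subgroup.closure_empty, 0, 1, 1, 0, le_rfl, le_rfl, ?_, ?_⟩
    · intro n g hg hg1
      exact absurd (by simpa using hg.mem_closure) hg1
    · simp
  | sup_zpowers K t hK ht ih =>
    have hn := hK.normal
    have hn' := (hK.sup_zpowers _ t ht).normal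
    obtain ⟨B, hfin, hB, k, m, D, l, hm, hD, hsep, hind⟩ := ih
    obtain ⟨k₀, hk₀⟩ := exists_isWordOfLength_of_mem_of_insert hfin hB t
    obtain ⟨r, c, hr, hle, hnot⟩ := exists_powerSubgroup_sup_zpowers K t
    -- The new constants are chosen so that the new power subgroup meets `K` inside `powerSubgroup K
    -- (m * q ^ D)`.
    have hexp : ∀ q : ℕ, r * m ^ (c + 1) * q ^ (D * (c + 1)) = r * (m * q ^ D) ^ (c + 1) := by
      intro q
      rw [mul_pow, pow_mul, mul_assoc]
    refine ⟨insert t B, hfin.insert t, ?_, (k₀ + 2) * k + 1, r * m ^ (c + 1), D * (c + 1), l + 1,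
      Nat.mul_pos hr (pow_pos hm _), Nat.mul_pos hD (Nat.succ_pos c), ?_, ?_⟩
    · rw [Set.insert_eq, Subgroup.closure_union, hB, ← Subgroup.zpowers_eq_closure, sup_comm]
    · intro n g hg hg1
      by_cases hgK : g ∈ K
      · obtain ⟨a, ha1, ha, hsep'⟩ := hsep _ g ((hk₀ n g hg).1 hgK) hg1
        refine ⟨a, ha1, ha.trans ?_, fun q hq hqa hmem => hsep' q hq hqa ?_⟩
        · have h1 : 1 ≤ (n + 2) ^ k₀ := Nat.one_le_pow _ _ (by omega)
          have h2 : (n + 2) ^ k₀ + 2 ≤ (n + 2) ^ (k₀ + 2) := by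
            have h3 : 4 ≤ (n + 2) ^ 2 := Nat.pow_le_pow_left (by omega : 2 ≤ n + 2) 2
            rw [pow_add]
            nlinarith [Nat.mul_le_mul_left ((n + 2) ^ k₀) h3]
          calc ((n + 2) ^ k₀ + 2) ^ k ≤ ((n + 2) ^ (k₀ + 2)) ^ k := Nat.pow_le_pow_left h2 k
            _ = (n + 2) ^ ((k₀ + 2) * k) := (pow_mul _ _ _).symm
            _ ≤ _ := Nat.pow_le_pow_right (by omega) (Nat.le_succ _)
        · rw [hexp] at hmem
          exact hle _ (Nat.mul_pos hm (pow_pos hq D)) ⟨hmem, hgK⟩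
      · obtain ⟨h, hh, i, hi0, hin, rfl⟩ := (hk₀ n g hg).2 hgK
        -- Outside `K` the exponent of `t` itself serves as `a`; the new power is a multiple of `r *
        -- q` because `D` is positive.
        refine ⟨i.natAbs, Int.natAbs_pos.2 hi0, ?_, fun q hq hqa hmem => ?_⟩
        · exact (by omega : i.natAbs ≤ n + 2).trans (Nat.le_self_pow (Nat.succ_ne_zero _) _)
        · refine hnot q h hh i hgK (fun h => hqa (Int.natCast_dvd.1 h)) ?_
          refine powerSubgroup_le_of_dvd _ ?_ hmem
          rw [hexp]
          refine mul_dvd_mul_left r (dvd_pow ?_ (Nat.succ_ne_zero c))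
          exact Dvd.dvd.mul_left (dvd_pow_self q (by omega)) m
    · intro e he
      obtain ⟨h1, h2⟩ := powerSubgroup_relIndex_sup_zpowers hn' he (hind e he).1
      refine ⟨h1, h2.trans ?_⟩
      rw [pow_succ']
      exact Nat.mul_le_mul_left e (hind e he).2

theorem IsWordOfLength.change_generators {B S : Set G} {R : ℕ}
    (hR : ∀ s ∈ S, IsWordOfLength B R s) {n : ℕ} {g : G} (hg : IsWordOfLength S n g) :
    IsWordOfLength B (n * R) g := by
  obtain ⟨l, hl, rfl, hln⟩ := hg
  refine IsWordOfLength.mono ?_ (Nat.mul_le_mul_right R hln)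
  clear hln
  induction l with
  | nil => exact isWordOfLength_one _
  | cons x l ih =>
    have hx : IsWordOfLength B R x := by
      rcases hl x List.mem_cons_self with h | h
      · exact hR x h
      · simpa using (hR _ h).inv
    rw [List.prod_cons, List.length_cons, add_mul, one_mul, add_comm]
    exact hx.mul (ih fun y hy => hl y (List.mem_cons_of_mem x hy))

theorem exists_nilDetection_le [Group.IsNilpotent G] {S : Set G} (hfin : S.Finite)
    (hS : Subgroup.closure S = ⊤) :
    ∃ R k m D l : ℕ, ∀ n (g : G), wordLength S g ≤ n → g ≠ 1 →
      nilDetection g ≤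
        (((m * (2 * (k * (Nat.log 2 (n * R + 2) + 1) + 1)) ^ D) ^ l : ℕ) : ℕ∞) := by
  obtain ⟨B, -, hB, k, m, D, l, hm, -, hsep, hind⟩ := (centralChain_top hfin hS).exists_separation
  obtain ⟨R, hR⟩ := hfin.exists_uniform_nat (P := fun s R => IsWordOfLength B R s)
    (fun s a b hab h => h.mono hab) fun s _ => exists_isWordOfLength (hB ▸ Subgroup.mem_top s)
  refine ⟨R, k, m, D, l, fun n g hgn hg1 => ?_⟩
  obtain ⟨a, ha1, ha, hsep'⟩ := hsep _ g
    (((isWordOfLength_wordLength hS g).mono hgn).change_generators hR) hg1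
  -- The final `+ 1` makes `a < 2 ^ N` strict, so some `q ≤ 2 * N` does not divide `a`.
  set N := k * (Nat.log 2 (n * R + 2) + 1) + 1 with hN
  have haN : a < 2 ^ N := by
    have h1 : n * R + 2 ≤ 2 ^ (Nat.log 2 (n * R + 2) + 1) :=
      (Nat.lt_pow_succ_log_self one_lt_two _).le
    calc a ≤ (2 ^ (Nat.log 2 (n * R + 2) + 1)) ^ k := ha.trans (Nat.pow_le_pow_left h1 k)
      _ = 2 ^ (k * (Nat.log 2 (n * R + 2) + 1)) := by rw [← pow_mul, mul_comm]
      _ < 2 ^ N := Nat.pow_lt_pow_right one_lt_two (Nat.lt_succ_self _)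
  obtain ⟨q, hq1, hqN, hqa⟩ := Nat.exists_not_dvd_of_lt_two_pow ha1 haN
  have he : 1 ≤ m * q ^ D := Nat.mul_pos hm (pow_pos hq1 D)
  obtain ⟨hi0, hi⟩ := hind _ he
  rw [Subgroup.relIndex_top_right] at hi0 hi
  have hcard : Nat.card (G ⧸ powerSubgroup (⊤ : Subgroup G) (m * q ^ D)) ≤
      (m * (2 * N) ^ D) ^ l :=
    hi.trans (Nat.pow_le_pow_left (Nat.mul_le_mul_left m (Nat.pow_le_pow_left hqN D)) l)
  refine le_trans (sInf_le ?_) (Nat.cast_le.2 hcard)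
  exact ⟨powerSubgroup ⊤ (m * q ^ D), inferInstance, Nat.finite_of_card_ne_zero hi0,
    inferInstance, hsep' q hq1 hqa, rfl⟩

theorem polynomialInLog_nilGrowth [Group.IsNilpotent G] {S : Set G} (hfin : S.Finite)
    (hS : Subgroup.closure S = ⊤) : PolynomialInLog (fun n => (nilGrowth S n : ENNReal)) := by
  obtain ⟨R, k, m, D, l, h⟩ := exists_nilDetection_le hfin hS
  -- `R + 3` ensures `n * R + 2 ≤ C * n` and `3 ≤ C * n`, hence a logarithm `L ≥ 1`. The other term
  -- is the coefficient arising from `2 * N ≤ (6 * k + 2) * L`.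
  set C := R + 3 + m ^ l * (6 * k + 2) ^ (D * l) with hC
  refine ⟨D * l, C, fun n hn => ?_⟩
  set N := k * (Nat.log 2 (n * R + 2) + 1) + 1 with hN
  have hgrow : nilGrowth S n ≤ (((m * (2 * N) ^ D) ^ l : ℕ) : ℕ∞) :=
    iSup₂_le fun g hg => h n g hg.2 hg.1
  have hgrow' : (nilGrowth S n : ENNReal) ≤ (((m * (2 * N) ^ D) ^ l : ℕ) : ENNReal) := by
    exact_mod_cast ENat.toENNReal_le.2 hgrow
  refine hgrow'.trans ?_
  have hn' : (1 : ℝ) ≤ n := by exact_mod_cast hn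
  have hCn : n * R + 2 ≤ C * n := by
    rw [hC]
    nlinarith [Nat.zero_le (m ^ l * (6 * k + 2) ^ (D * l) * n)]
  have hC3 : 3 ≤ C * n := by
    rw [hC]
    nlinarith [Nat.zero_le (m ^ l * (6 * k + 2) ^ (D * l) * n), Nat.zero_le (R * n)]
  set L := Real.log ((C * n : ℕ) : ℝ) with hL
  have hL1 : 1 ≤ L := by
    rw [hL, Real.le_log_iff_exp_le (by positivity)]
    have : (3 : ℝ) ≤ ((C * n : ℕ) : ℝ) := by exact_mod_cast hC3
    linarith [Real.exp_one_lt_d9]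
  have hlog : (Nat.log 2 (n * R + 2) : ℝ) ≤ 2 * L := by
    have h1 : (2 : ℝ) ^ Nat.log 2 (n * R + 2) ≤ ((C * n : ℕ) : ℝ) := by
      exact_mod_cast (Nat.pow_log_le_self 2 (by omega)).trans hCn
    have h2 := Real.log_le_log (by positivity) h1
    rw [Real.log_pow] at h2
    have h3 := Real.log_two_gt_d9
    have h4 : (0 : ℝ) ≤ Nat.log 2 (n * R + 2) := Nat.cast_nonneg _
    nlinarith
  have hNL : 2 * (N : ℝ) ≤ (6 * k + 2) * L := by
    have hk : (0 : ℝ) ≤ k := Nat.cast_nonneg k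
    rw [hN]
    push_cast
    nlinarith [mul_le_mul_of_nonneg_left hlog hk, mul_le_mul_of_nonneg_left hL1 hk]
  have hreal : (((m * (2 * N) ^ D) ^ l : ℕ) : ℝ) ≤ C * L ^ (D * l) := by
    push_cast
    calc ((m : ℝ) * (2 * N) ^ D) ^ l ≤ (m * ((6 * k + 2) * L) ^ D) ^ l := by gcongr
      _ = (m ^ l * (6 * k + 2) ^ (D * l)) * L ^ (D * l) := by
        rw [mul_pow, mul_pow, mul_pow, ← pow_mul, ← pow_mul, mul_assoc]
      _ ≤ C * L ^ (D * l) := by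
        refine mul_le_mul_of_nonneg_right ?_ (by positivity)
        rw [hC]
        push_cast
        linarith [Nat.cast_nonneg (α := ℝ) R]
  calc (((m * (2 * N) ^ D) ^ l : ℕ) : ENNReal)
      = ENNReal.ofReal (((m * (2 * N) ^ D) ^ l : ℕ) : ℝ) := (ENNReal.ofReal_natCast _).symm
    _ ≤ ENNReal.ofReal (C * L ^ (D * l)) := ENNReal.ofReal_le_ofReal hreal
    _ = C * ENNReal.ofReal (L ^ (D * l)) := by
      rw [ENNReal.ofReal_mul (Nat.cast_nonneg C), ENNReal.ofReal_natCast]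

end PolynomialDistortion

theorem theorem3 {G : Type*} [Group G] (S : Set G) (hSfin : S.Finite)
    (hS : Subgroup.closure S = ⊤) :
    (PolynomialInLog (fun n => (nilGrowth S n : ENNReal)) ↔ Group.IsNilpotent G) ∧
    (¬ Group.IsNilpotent G →
      GrowthLE (fun n => (n : ENNReal)) (fun n => (nilGrowth S n : ENNReal))) := by
  refine ⟨⟨fun h => ?_, fun h => polynomialInLog_nilGrowth hSfin hS⟩,
    growthLE_nilGrowth_of_not_isNilpotent hS⟩
  by_contra hG
  exact not_polynomialInLog_of_linear_growthLE (growthLE_nilGrowth_of_not_isNilpotent hS hG) h
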